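/- Let $n\ge 0$, $A\in\mathbb R^{n\times n}$ and $q\in\mathbb R^n$. Put $$\mathcal F=\{x\in\mathbb R^n: x>0,\ Ax+q>0\},\qquad \mathcal F_1=\mathcal F\times\mathbb R^n_{++}\times\mathbb R^n_{++},$$ where the inequalities are componentwise and $\mathbb R^n_{++}$ is the open positive orthant. For $y^{(0)}=(x^{(0)},z_1^{(0)},z_2^{(0)})\in\mathcal F_1$ define the homotopy map $H_{y^{(0)}}:\mathbb R^{3n}\times(0,1]\to\mathbb R^{3n}$ by $$H_{y^{(0)}}(y,\lambda)=\begin{pmatrix}(1-\lambda)\big[(A+A^t)x+q-z_1-A^tz_2\big]+\lambda(x-x^{(0)})\\ Z_1x-\lambda Z_1^{(0)}x^{(0)}\\ Z_2(Ax+q)-\lambda Z_2^{(0)}(Ax^{(0)}+q)\end{pmatrix},\qquad y=(x,z_1,z_2),$$ where $Z_j=\mathrm{diag}(z_j)$ and $Z_j^{(0)}=\mathrm{diag}(z_j^{(0)})$ for $j=1,2$. Then for almost every $y^{(0)}\in\mathcal F_1$ (with respect to Lebesgue measure on $\mathbb R^{3n}$) the following hold. (i) $0$ is a regular value of $H_{y^{(0)}}$: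 at every $(y,\lambda)\in\mathbb R^{3n}\times(0,1]$ with $H_{y^{(0)}}(y,\lambda)=0$, the derivative $DH_{y^{(0)}}(y,\lambda):\mathbb R^{3n}\times\mathbb R\to\mathbb R^{3n}$ (one-sided in $\lambda$ at $\lambda=1$) is surjective. (ii) The zero set $\{(y,\lambda)\in\mathcal F_1\times(0,1]: H_{y^{(0)}}(y,\lambda)=0\}$ contains a smooth curve $\Gamma_{y^{(0)}}$ starting from $(y^{(0)},1)$. More precisely, the connected component $\Gamma_{y^{(0)}}$ of this zero set that contains $(y^{(0)},1)$ is a connected, embedded, one-dimensional $C^\infty$ submanifold with boundary of $\mathbb R^{3n}\times\mathbb R$, whose boundary is the single point $(y^{(0)},1)$. -/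

import Mathlib

open MeasureTheory Set
open scoped ContDiff Matrix

noncomputable section

/-- The space `ℝ³ⁿ = ℝⁿ × ℝⁿ × ℝⁿ` of triples `y = (x, z₁, z₂)`. Only its topology, its smooth
structure and its Lebesgue measure are used. -/
abbrev TripleSpace (n : ℕ) : Type := (Fin n → ℝ) × (Fin n → ℝ) × (Fin n → ℝ)

/-- `𝓕 = {x : x > 0, A x + q > 0}` (componentwise strict inequalities). -/
def strictlyFeasible {n : ℕ} (A : Matrix (Fin n) (Fin n) ℝ) (q : Fin n → ℝ) :
    Set (Fin n → ℝ) :=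
  {x | (∀ i, 0 < x i) ∧ ∀ i, 0 < (A *ᵥ x + q) i}

/-- `𝓕₁ = 𝓕 × ℝⁿ₊₊ × ℝⁿ₊₊`. -/
def strictlyFeasibleTriples {n : ℕ} (A : Matrix (Fin n) (Fin n) ℝ) (q : Fin n → ℝ) :
    Set (TripleSpace n) :=
  strictlyFeasible A q ×ˢ {z₁ | ∀ i, 0 < z₁ i} ×ˢ {z₂ | ∀ i, 0 < z₂ i}

/-- The homotopy map `(y, λ) ↦ H_{y⁰}(y, λ)` with `y = (x, z₁, z₂)`, `y⁰ = (x⁰, z₁⁰, z₂⁰)`.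
Products of vectors are componentwise: `z₁ * x = diag(z₁) x`. -/
def lcpHomotopy {n : ℕ} (A : Matrix (Fin n) (Fin n) ℝ) (q : Fin n → ℝ) (y₀ : TripleSpace n) :
    TripleSpace n × ℝ → TripleSpace n
  | ((x, z₁, z₂), l) =>
    ((1 - l) • ((A + Aᵀ) *ᵥ x + q - z₁ - Aᵀ *ᵥ z₂) + l • (x - y₀.1),
      z₁ * x - l • (y₀.2.1 * y₀.1),
      z₂ * (A *ᵥ x + q) - l • (y₀.2.2 * (A *ᵥ y₀.1 + q)))

/-- `c` is a regular value of `f : D → F`: at every point of `D` where `f` takes the value `c`,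
the derivative of `f` (taken within `D`) exists and is onto. -/
def IsRegularValueOn {E F : Type*} [NormedAddCommGroup E] [NormedSpace ℝ E]
    [NormedAddCommGroup F] [NormedSpace ℝ F] (f : E → F) (D : Set E) (c : F) : Prop :=
  ∀ p ∈ D, f p = c →
    DifferentiableWithinAt ℝ f D p ∧ Function.Surjective (fderivWithin ℝ f D p)

/-- Near its point `p`, the set `Γ` has a regular `C^∞` parametrization by the interval `I`:
some neighbourhood of `p` in `Γ` is the image of `I` under a smooth map `γ` with nonvanishing
derivative which is a homeomorphism onto its image, and `γ 0 = p`. -/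
def HasSmoothParametrizationAt {E : Type*} [NormedAddCommGroup E] [NormedSpace ℝ E]
    (Γ : Set E) (p : E) (I : Set ℝ) : Prop :=
  ∃ (U : Set E) (γ : ℝ → E), IsOpen U ∧ p ∈ U ∧ γ 0 = p ∧ γ '' I = Γ ∩ U ∧
    ContDiffOn ℝ ∞ γ I ∧ (∀ t ∈ I, derivWithin γ I t ≠ 0) ∧
    Topology.IsEmbedding (I.domRestrict γ)

/-- `Γ` is a smooth curve starting from `p`: a connected, embedded, one-dimensional `C^∞`
submanifold with boundary of `E`, whose boundary consists of the single point `p`. -/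
def IsSmoothCurveFrom {E : Type*} [NormedAddCommGroup E] [NormedSpace ℝ E]
    (Γ : Set E) (p : E) : Prop :=
  IsConnected Γ ∧ p ∈ Γ ∧ HasSmoothParametrizationAt Γ p (Ico 0 1) ∧
    ∀ x ∈ Γ, x ≠ p → HasSmoothParametrizationAt Γ x (Ioo (-1) 1)

/-- The zero set `{(y, λ) ∈ 𝓕₁ × (0, 1] : H_{y⁰}(y, λ) = 0}`. -/
def homotopyZeroSet {n : ℕ} (A : Matrix (Fin n) (Fin n) ℝ) (q : Fin n → ℝ)
    (y₀ : TripleSpace n) : Set (TripleSpace n × ℝ) :=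
  {p | p ∈ strictlyFeasibleTriples A q ×ˢ Ioc (0 : ℝ) 1 ∧ lcpHomotopy A q y₀ p = 0}

end

/-! For `λ > 0` the homotopy equals `λ • (G(y, λ) - c(y₀))`, where `G` is `levelMap` and `c` is
`complementarityMap`. The starting point thus enters only through a constant: the zeros of all the
homotopies are level sets of one fixed map `G`, which lowers the dimension by one. Sard's theorem
makes the critical values of `G` null. On `𝓕₁` the map `c` has a differentiable inverse, so almost
no `y₀` is sent to a critical value (`ae_surjective_fderiv_levelMap`).

At a regular zero the inverse function theorem straightens the zero set into a line. On `λ = 1` the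
map `G` reduces to `c`, injective with injective derivative on `𝓕₁`. Hence `(y₀, 1)` is the only
zero there and the curve crosses that slice transversally, which makes it the only boundary point.

Sard's theorem is proved by stratifying critical points by rank. Straightening the nonzero rank and
applying Fubini reduces to points where `Df = 0`. If also `D²f = 0`, a Hölder estimate of exponent 3
bounds the Hausdorff dimension of the image; otherwise the points lie locally on a hypersurface
whose dimension is that of the target. -/

/-! ### Linear completion and the smooth inverse function theorem -/

section LinearAlgebra

variable {E A : Type*} [NormedAddCommGroup E] [NormedSpace ℝ E] [FiniteDimensional ℝ E]
  [NormedAddCommGroup A] [NormedSpace ℝ A]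

open Module in
/-- A surjective linear map can be completed to a linear isomorphism onto a product. -/
theorem exists_bijective_prod_of_surjective {B : Type*} [FiniteDimensional ℝ A]
    [NormedAddCommGroup B] [NormedSpace ℝ B] [FiniteDimensional ℝ B] (a : E →L[ℝ] A) (ha : Function.Surjective a)
    (h : finrank ℝ E = finrank ℝ A + finrank ℝ B) :
    ∃ b : E →L[ℝ] B, Function.Bijective (a.prod b) := by
  have hk : finrank ℝ (LinearMap.ker (a : E →ₗ[ℝ] A)) = finrank ℝ B := by
    have h1 := LinearMap.finrank_range_add_finrank_ker (a : E →ₗ[ℝ] A)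
    rw [LinearMap.range_eq_top.2 ha, finrank_top] at h1
    omega
  obtain ⟨g, hg⟩ := LinearMap.exists_leftInverse_of_injective
    (LinearMap.ker (a : E →ₗ[ℝ] A)).subtype (Submodule.ker_subtype _)
  let e := LinearEquiv.ofFinrankEq _ _ hk
  -- `g` is a projection onto `ker a`, so a vector killed by `a` and by `e ∘ g` is zero.
  refine ⟨LinearMap.toContinuousLinearMap (e.toLinearMap ∘ₗ g), ?_⟩
  have hinj : Function.Injective
      (a.prod (LinearMap.toContinuousLinearMap (e.toLinearMap ∘ₗ g)) : E →ₗ[ℝ] A × B) := by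
    rw [← LinearMap.ker_eq_bot, LinearMap.ker_eq_bot']
    intro x hx
    have h1 : a x = 0 := congrArg Prod.fst hx
    have h2 : e (g x) = 0 := congrArg Prod.snd hx
    have h3 : g x = 0 := by simpa using h2
    have h4 := LinearMap.congr_fun hg ⟨x, h1⟩
    simp only [LinearMap.coe_comp, Function.comp_apply, Submodule.subtype_apply, h3,
      LinearMap.id_apply] at h4
    exact (congrArg Subtype.val h4).symm
  exact ⟨hinj, (LinearMap.injective_iff_surjective_of_finrank_eq_finrank
    (by rw [h, finrank_prod])).1 hinj⟩

/-- The smooth inverse function theorem, with a prescribed bound on the source. -/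
theorem exists_smooth_openPartialHomeomorph {f : E → A} {U : Set E} {p : E} (hU : IsOpen U)
    (hp : p ∈ U) (hf : ContDiffOn ℝ ∞ f U) (hb : Function.Bijective (fderiv ℝ f p)) :
    ∃ e : OpenPartialHomeomorph E A, (e : E → A) = f ∧ p ∈ e.source ∧ e.source ⊆ U ∧
      ContDiffOn ℝ ∞ e.symm e.target ∧
      ∀ x ∈ e.source, Function.Bijective (fderiv ℝ f x) := by
  have hfa : ∀ x ∈ U, ContDiffAt ℝ ∞ f x := fun x hx => hf.contDiffAt (hU.mem_nhds hx)
  have hcont : ContinuousOn (fderiv ℝ f) U := hf.continuousOn_fderiv_of_isOpen hU (by simp)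
  -- Shrinking to points with invertible derivative makes the inverse smooth on the whole target,
  -- not only at `f p`.
  let V : Set E := U ∩ fderiv ℝ f ⁻¹' range ((↑) : (E ≃L[ℝ] A) → E →L[ℝ] A)
  have hV : IsOpen V := hcont.isOpen_inter_preimage hU ContinuousLinearEquiv.isOpen
  have : FiniteDimensional ℝ A := (LinearEquiv.ofBijective (fderiv ℝ f p : E →ₗ[ℝ] A) hb).finiteDimensional
  let Lp : E ≃L[ℝ] A :=
    (LinearEquiv.ofBijective (fderiv ℝ f p : E →ₗ[ℝ] A) hb).toContinuousLinearEquiv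
  have hLp : (Lp : E →L[ℝ] A) = fderiv ℝ f p := by ext x; rfl
  have hder : HasFDerivAt f (Lp : E →L[ℝ] A) p := by
    rw [hLp]; exact ((hfa p hp).differentiableAt (by simp)).hasFDerivAt
  let e₀ := (hfa p hp).toOpenPartialHomeomorph f hder (by simp)
  have he₀ : (e₀ : E → A) = f := rfl
  have hs : (e₀.restrOpen V hV).source = e₀.source ∩ V := rfl
  refine ⟨e₀.restrOpen V hV, rfl, ?_, ?_, ?_, ?_⟩
  · rw [hs]
    exact ⟨(hfa p hp).mem_toOpenPartialHomeomorph_source hder (by simp), hp, Lp, hLp⟩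
  · rw [hs]; exact fun x hx => hx.2.1
  · intro y hy
    have hx := (e₀.restrOpen V hV).map_target hy
    rw [hs] at hx
    obtain ⟨L, hL⟩ := hx.2.2
    refine ((e₀.restrOpen V hV).contDiffAt_symm (f₀' := L) hy ?_ ?_).contDiffWithinAt
    · rw [hL]; exact ((hfa _ hx.2.1).differentiableAt (by simp)).hasFDerivAt
    · exact hfa _ hx.2.1
  · intro x hx
    rw [hs] at hx
    obtain ⟨L, hL⟩ := hx.2.2
    rw [← hL]; exact L.bijective

end LinearAlgebra

/-! ### Taylor-type estimates -/

section Holder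

variable {E F : Type*} [NormedAddCommGroup E] [NormedSpace ℝ E]
  [NormedAddCommGroup F] [NormedSpace ℝ F]

/-- The mean value inequality on `s` cut by the closed ball about `x` of radius `‖y - x‖`, where the
derivative bound becomes constant. Each use integrates once and gains one power. -/
theorem norm_sub_le_of_norm_fderiv_le_pow {f : E → F} {s : Set E} (hs : Convex ℝ s)
    (hf : ∀ z ∈ s, DifferentiableAt ℝ f z) {x y : E} (hx : x ∈ s) (hy : y ∈ s) {C : ℝ} (hC : 0 ≤ C)
    {k : ℕ} (hb : ∀ z ∈ s, ‖fderiv ℝ f z‖ ≤ C * ‖z - x‖ ^ k) :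
    ‖f y - f x‖ ≤ C * ‖y - x‖ ^ (k + 1) := by
  have := (hs.inter (convex_closedBall x ‖y - x‖)).norm_image_sub_le_of_norm_fderiv_le
    (f := f) (𝕜 := ℝ) (C := C * ‖y - x‖ ^ k) (x := x) (y := y) (fun z hz => hf z hz.1)
    (fun z hz => (hb z hz.1).trans (by
      have := mem_closedBall_iff_norm.1 hz.2
      gcongr)) ⟨hx, by simp⟩ ⟨hy, by simp [dist_eq_norm]⟩
  rwa [pow_succ, ← mul_assoc]

set_option maxSynthPendingDepth 3 in
/-- Where the first two derivatives vanish, a smooth map is locally Hölder of exponent `3`. -/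
theorem exists_holderOnWith_three {f : E → F} {U : Set E} (hU : IsOpen U)
    (hf : ContDiffOn ℝ ∞ f U) {p : E} (hp : p ∈ U) :
    ∃ C : NNReal, ∃ t ∈ nhds p, HolderOnWith C 3 f
      ({x | fderiv ℝ f x = 0 ∧ fderiv ℝ (fderiv ℝ f) x = 0} ∩ t) := by
  have h1 : ContDiffOn ℝ ∞ (fderiv ℝ f) U := hf.fderiv_of_isOpen hU (by simp)
  have h2 : ContDiffOn ℝ ∞ (fderiv ℝ (fderiv ℝ f)) U := h1.fderiv_of_isOpen hU (by simp)
  have h3 : ContinuousOn (fderiv ℝ (fderiv ℝ (fderiv ℝ f))) U :=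
    h2.continuousOn_fderiv_of_isOpen hU (by simp)
  have hn := hU.mem_nhds hp
  obtain ⟨C, hC⟩ : ∃ C : ℝ, ‖fderiv ℝ (fderiv ℝ (fderiv ℝ f)) p‖ < C := exists_gt _
  have hev := (h3.continuousAt hn).norm.eventually_lt_const hC
  obtain ⟨r, hr, hball⟩ := Metric.mem_nhds_iff.1 (Filter.inter_mem hn hev)
  have hC0 : 0 ≤ C := (norm_nonneg _).trans hC.le
  refine ⟨C.toNNReal, Metric.ball p r, Metric.ball_mem_nhds p hr, ?_⟩
  have hd : ∀ z ∈ Metric.ball p r, U ∈ nhds z := fun z hz => hU.mem_nhds (hball hz).1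
  rintro x ⟨⟨hx1, hx2⟩, hx⟩ y ⟨-, hy⟩
  -- Integrate three times from `x`, starting from the bound `C` on the third derivative; the lower
  -- derivatives vanish at `x`.
  have b2 : ∀ z ∈ Metric.ball p r, ‖fderiv ℝ (fderiv ℝ f) z‖ ≤ C * ‖z - x‖ ^ 1 := fun z hz => by
    have := norm_sub_le_of_norm_fderiv_le_pow (convex_ball p r) 
      (fun z hz => (h2.contDiffAt (hd z hz)).differentiableAt (by simp)) hx hz hC0 (k := 0)
      (fun w hw => by simpa using (hball hw).2.le)
    rwa [hx2, sub_zero] at this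
  have b1 : ∀ z ∈ Metric.ball p r, ‖fderiv ℝ f z‖ ≤ C * ‖z - x‖ ^ 2 := fun z hz => by
    have := norm_sub_le_of_norm_fderiv_le_pow (convex_ball p r) 
      (fun z hz => (h1.contDiffAt (hd z hz)).differentiableAt (by simp)) hx hz hC0 b2
    rwa [hx1, sub_zero] at this
  have b0 := norm_sub_le_of_norm_fderiv_le_pow (convex_ball p r) 
      (fun z hz => (hf.contDiffAt (hd z hz)).differentiableAt (by simp)) hx hy hC0 b1
  rw [edist_comm, edist_comm x y]
  rw [edist_eq_enorm_sub, edist_eq_enorm_sub, ← ofReal_norm, ← ofReal_norm,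
    ENNReal.ofReal_rpow_of_nonneg (norm_nonneg _) (by positivity)]
  rw [show ((C.toNNReal : NNReal) : ENNReal) = ENNReal.ofReal C from rfl,
    ← ENNReal.ofReal_mul hC0]
  refine ENNReal.ofReal_le_ofReal (b0.trans (le_of_eq ?_))
  norm_num

end Holder

/-! ### Sard's theorem with dimension drop one -/

section Sard

open Module

/-- The pulled-back outer measure `s ↦ μ (f '' s)` is countably subadditive, so no measurability of
`s` or its image is needed. -/
theorem measure_image_null_of_locally_null {E F : Type*} [TopologicalSpace E]
    [SecondCountableTopology E] [MeasurableSpace F] (μ : Measure F) {f : E → F} {s : Set E}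
    (h : ∀ x ∈ s, ∃ t ∈ nhds x, μ (f '' (s ∩ t)) = 0) : μ (f '' s) = 0 := by
  refine measure_null_of_locally_null (μ := OuterMeasure.comap f μ.toOuterMeasure) s fun x hx => ?_
  obtain ⟨t, ht, h0⟩ := h x hx
  refine ⟨s ∩ t, inter_mem_nhdsWithin s ht, h0⟩

variable {E F : Type*} [NormedAddCommGroup E] [NormedSpace ℝ E] [FiniteDimensional ℝ E]
  [NormedAddCommGroup F] [NormedSpace ℝ F] [FiniteDimensional ℝ F]
  [MeasurableSpace F] [BorelSpace F] (μ : Measure F) [μ.IsAddHaarMeasure]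

/-- The image of the set where the first two derivatives vanish is null. -/
theorem measure_image_fderiv_fderiv_eq_zero {f : E → F} {U : Set E} (hU : IsOpen U)
    (hf : ContDiffOn ℝ ∞ f U) (hd : finrank ℝ E < 3 * finrank ℝ F) :
    μ (f '' {x ∈ U | fderiv ℝ f x = 0 ∧ fderiv ℝ (fderiv ℝ f) x = 0}) = 0 := by
  have h1 := dimH_image_le_of_locally_holder_on (f := f) (r := 3) (by norm_num)
    (s := {x ∈ U | fderiv ℝ f x = 0 ∧ fderiv ℝ (fderiv ℝ f) x = 0}) (fun x hx => by
      obtain ⟨C, t, ht, hC⟩ := exists_holderOnWith_three hU hf hx.1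
      exact ⟨C, _, inter_mem_nhdsWithin _ ht, hC.mono fun y hy => ⟨hy.1.2, hy.2⟩⟩)
  have h2 : dimH (f '' {x ∈ U | fderiv ℝ f x = 0 ∧ fderiv ℝ (fderiv ℝ f) x = 0}) <
      ((finrank ℝ F : NNReal) : ENNReal) := by
    refine h1.trans_lt ?_
    rw [ENNReal.div_lt_iff (by simp) (by simp)]
    refine (dimH_mono (subset_univ _)).trans_lt ?_
    rw [Real.dimH_univ_eq_finrank]
    have : (finrank ℝ E : ENNReal) < ((3 * finrank ℝ F : ℕ) : ENNReal) := by exact_mod_cast hd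
    refine this.trans_le (le_of_eq ?_)
    push_cast
    ring
  have h3 := hausdorffMeasure_of_dimH_lt h2
  have : (μH[finrank ℝ F] : Measure F).IsAddHaarMeasure := inferInstance
  exact Measure.absolutelyContinuous_isAddHaarMeasure μ μH[finrank ℝ F] (by exact_mod_cast h3)

/-- The image of the set where the derivative vanishes is null, if the dimension drops by one. -/
theorem measure_image_fderiv_eq_zero {f : E → F} {U : Set E} (hU : IsOpen U)
    (hf : ContDiffOn ℝ ∞ f U) (hd : finrank ℝ E = finrank ℝ F + 1) (hF : 0 < finrank ℝ F) :
    μ (f '' {x ∈ U | fderiv ℝ f x = 0}) = 0 := by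
  have hsub : {x ∈ U | fderiv ℝ f x = 0} ⊆
      {x ∈ U | fderiv ℝ f x = 0 ∧ fderiv ℝ (fderiv ℝ f) x = 0} ∪
      {x ∈ U | fderiv ℝ f x = 0 ∧ fderiv ℝ (fderiv ℝ f) x ≠ 0} := by
    rintro x ⟨hx, hx1⟩
    by_cases h : fderiv ℝ (fderiv ℝ f) x = 0
    exacts [Or.inl ⟨hx, hx1, h⟩, Or.inr ⟨hx, hx1, h⟩]
  refine measure_mono_null (image_mono hsub) ?_
  rw [image_union]
  -- With `d = finrank ℝ F ≥ 1`, `d + 1 < 3 * d`; exponent 2 would fail at `d = 1`.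
  refine measure_union_null (measure_image_fderiv_fderiv_eq_zero μ hU hf (by omega)) ?_
  refine measure_image_null_of_locally_null μ ?_
  rintro p ⟨hp, -, hp2⟩
  have h1 : ContDiffOn ℝ ∞ (fderiv ℝ f) U := hf.fderiv_of_isOpen hU (by simp)
  have hdf : DifferentiableAt ℝ (fderiv ℝ f) p :=
    (h1.contDiffAt (hU.mem_nhds hp)).differentiableAt (by simp)
  obtain ⟨u, v, huv⟩ : ∃ u v, fderiv ℝ (fderiv ℝ f) p u v ≠ 0 := by
    by_contra! h
    exact hp2 (by ext u v; exact h u v)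
  obtain ⟨φ, hφ⟩ : ∃ φ : F →L[ℝ] ℝ, φ (fderiv ℝ (fderiv ℝ f) p u v) ≠ 0 := by
    obtain ⟨φ, -, hφ⟩ := exists_dual_vector ℝ _ (norm_ne_zero_iff.2 huv)
    exact ⟨φ, by rw [hφ]; simpa using huv⟩
  let ev : (E →L[ℝ] F) →L[ℝ] ℝ := φ ∘L ContinuousLinearMap.apply ℝ F v
  -- A scalar component of `Df`: it vanishes at every critical point but has nonzero derivative at
  -- `p`, so nearby critical points lie on the hypersurface `w = 0`.
  let w : E → ℝ := fun x => ev (fderiv ℝ f x)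
  have hw : fderiv ℝ w p = ev ∘L fderiv ℝ (fderiv ℝ f) p :=
    (ev.hasFDerivAt.comp p hdf.hasFDerivAt).fderiv
  have hwd : DifferentiableAt ℝ w p := (ev.hasFDerivAt.comp p hdf.hasFDerivAt).differentiableAt
  have hsurj : Function.Surjective (fderiv ℝ w p) := by
    refine LinearMap.surjective (f := (fderiv ℝ w p : E →ₗ[ℝ] ℝ)) fun h => hφ ?_
    have := LinearMap.congr_fun h u
    rw [hw] at this
    exact this
  obtain ⟨b, hb⟩ := exists_bijective_prod_of_surjective (B := F) (fderiv ℝ w p) hsurj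
    (by rw [hd, finrank_self, add_comm])
  have hΨ : fderiv ℝ (fun x => (w x, b x)) p = (fderiv ℝ w p).prod b := by
    rw [(hwd.hasFDerivAt.prodMk b.hasFDerivAt).fderiv]
  obtain ⟨e, he, hpe, hesub, hsymm, -⟩ := exists_smooth_openPartialHomeomorph
    (f := fun x => (w x, b x)) hU hp
    ((ev.contDiff.comp_contDiffOn h1).prodMk b.contDiff.contDiffOn) (by rw [hΨ]; exact hb)
  refine ⟨e.source, e.open_source.mem_nhds hpe, ?_⟩
  let T : Set F := {y | ((0 : ℝ), y) ∈ e.target ∧ fderiv ℝ f (e.symm (0, y)) = 0}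
  have hT : f '' ({x ∈ U | fderiv ℝ f x = 0 ∧ fderiv ℝ (fderiv ℝ f) x ≠ 0} ∩ e.source) ⊆
      (fun y => f (e.symm (0, y))) '' T := by
    rintro - ⟨x, ⟨⟨hxU, hx1, -⟩, hxe⟩, rfl⟩
    have hex : e x = (0, b x) := by rw [he]; simp [w, hx1]
    have hl : e.symm (0, b x) = x := by rw [← hex, e.left_inv hxe]
    refine ⟨b x, ⟨?_, ?_⟩, ?_⟩
    · rw [← hex]; exact e.map_source hxe
    · rw [hl, hx1]
    · simp only [hl]
  -- On the hypersurface, parametrized by `F` itself, `f` becomes a map `F → F` with zero derivative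
  -- on `T`.
  refine measure_mono_null hT (addHaar_image_eq_zero_of_det_fderivWithin_eq_zero μ
    (f' := fun _ => 0) (fun y hy => HasFDerivAt.hasFDerivWithinAt ?_) fun y hy => ?_)
  · have hx := e.map_target hy.1
    have h2 : DifferentiableAt ℝ f (e.symm (0, y)) :=
      (hf.contDiffAt (hU.mem_nhds (hesub hx))).differentiableAt (by simp)
    have h3 : DifferentiableAt ℝ e.symm ((0 : ℝ), y) :=
      (hsymm.contDiffAt (e.open_target.mem_nhds hy.1)).differentiableAt (by simp)
    have h4 : HasFDerivAt (fun y => ((0 : ℝ), y)) (ContinuousLinearMap.inr ℝ ℝ F) y :=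
      (ContinuousLinearMap.inr ℝ ℝ F).hasFDerivAt
    have h5 := h2.hasFDerivAt.comp y (h3.hasFDerivAt.comp y h4)
    rw [hy.2, ContinuousLinearMap.zero_comp] at h5
    exact h5
  · rw [ContinuousLinearMap.det, ContinuousLinearMap.toLinearMap_zero, LinearMap.det_zero]
    simp [hF.ne']

/-- Near each point, the points at which the derivative has a fixed non-maximal rank have a null
image. -/
theorem exists_nhds_measure_image_finrank_range_fderiv_eq {f : E → F} {U : Set E} (hU : IsOpen U)
    (hf : ContDiffOn ℝ ∞ f U) (hd : finrank ℝ E = finrank ℝ F + 1) {r m : ℕ}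
    (hr : r + m = finrank ℝ F) (hm : 0 < m) {p : E} (hp : p ∈ U)
    (hpr : finrank ℝ (fderiv ℝ f p).range = r) :
    ∃ t ∈ nhds p, μ (f '' ({x ∈ U | finrank ℝ (fderiv ℝ f x).range = r} ∩ t)) = 0 := by
  -- Target coordinates whose first block restricts to an isomorphism on the range of `Df(p)`.
  obtain ⟨c, hc⟩ : ∃ c : F ≃L[ℝ] (Fin r → ℝ) × (Fin m → ℝ),
      Function.Surjective fun v => (c (fderiv ℝ f p v)).1 := by
    let eR : (fderiv ℝ f p).range ≃ₗ[ℝ] (Fin r → ℝ) := LinearEquiv.ofFinrankEq _ _ (by simp [hpr])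
    obtain ⟨g, hg⟩ := LinearMap.exists_leftInverse_of_injective
      (fderiv ℝ f p).range.subtype (Submodule.ker_subtype _)
    let a : F →L[ℝ] (Fin r → ℝ) := LinearMap.toContinuousLinearMap (eR.toLinearMap ∘ₗ g)
    have ha : ∀ v, a (fderiv ℝ f p v) = eR ⟨fderiv ℝ f p v, v, rfl⟩ := fun v =>
      congrArg eR (LinearMap.congr_fun hg ⟨fderiv ℝ f p v, v, rfl⟩)
    have has : Function.Surjective fun v => a (fderiv ℝ f p v) := fun y => by
      obtain ⟨⟨z, v, hv⟩, hz⟩ := eR.surjective y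
      refine ⟨v, ?_⟩
      simp only [ha, ← hz]
      congr 2
    obtain ⟨b, hb⟩ := exists_bijective_prod_of_surjective (B := Fin m → ℝ) a
      (fun y => (has y).imp' _ fun v hv => hv) (by simp [hr])
    exact ⟨(LinearEquiv.ofBijective (a.prod b : F →ₗ[ℝ] (Fin r → ℝ) × (Fin m → ℝ))
      hb).toContinuousLinearEquiv, has⟩
  let c₁ : F →L[ℝ] (Fin r → ℝ) := ContinuousLinearMap.fst ℝ (Fin r → ℝ) (Fin m → ℝ) ∘L ↑c
  let c₂ : F →L[ℝ] (Fin m → ℝ) := ContinuousLinearMap.snd ℝ (Fin r → ℝ) (Fin m → ℝ) ∘L ↑c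
  have hfd : ∀ x ∈ U, DifferentiableAt ℝ f x := fun x hx =>
    (hf.contDiffAt (hU.mem_nhds hx)).differentiableAt (by simp)
  obtain ⟨b, hb⟩ := exists_bijective_prod_of_surjective (B := Fin (m + 1) → ℝ)
    (c₁ ∘L fderiv ℝ f p) hc (by simp [hd, ← hr, add_assoc])
  have hΨ : ∀ x ∈ U, fderiv ℝ (fun x => (c₁ (f x), b x)) x = (c₁ ∘L fderiv ℝ f x).prod b :=
    fun x hx => ((c₁.hasFDerivAt.comp x (hfd x hx).hasFDerivAt).prodMk b.hasFDerivAt).fderiv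
  obtain ⟨e, he, hpe, hesub, hsymm, hbij⟩ := exists_smooth_openPartialHomeomorph
    (f := fun x => (c₁ (f x), b x)) hU hp
    ((c₁.contDiff.comp_contDiffOn hf).prodMk b.contDiff.contDiffOn)
    (by rw [hΨ p hp]; exact hb)
  have hgs : ContDiffOn ℝ ∞ (fun q => c₂ (f (e.symm q))) e.target :=
    c₂.contDiff.comp_contDiffOn (hf.comp hsymm fun q hq => hesub (e.map_target hq))
  let g : (Fin r → ℝ) × (Fin (m + 1) → ℝ) → (Fin m → ℝ) := fun q => c₂ (f (e.symm q))
  let Z : Set ((Fin r → ℝ) × (Fin (m + 1) → ℝ)) :=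
    {q | fderiv ℝ g q ∘L ContinuousLinearMap.inr ℝ _ _ = 0}
  -- Compactness of `Q` makes the image `N` compact, hence measurable, as Fubini requires.
  obtain ⟨Q, hQ, hQt, hQc⟩ := local_compact_nhds (e.open_target.mem_nhds (e.map_source hpe))
  have hgd : ∀ q ∈ e.target, DifferentiableAt ℝ g q := fun q hq =>
    (hgs.contDiffAt (e.open_target.mem_nhds hq)).differentiableAt (by simp)
  let N : Set ((Fin r → ℝ) × (Fin m → ℝ)) := (fun q => (q.1, g q)) '' (Q ∩ Z)
  have hNc : IsCompact N := by
    have h1 : ContinuousOn (fun q => fderiv ℝ g q ∘L ContinuousLinearMap.inr ℝ _ _) Q :=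
      ((hgs.continuousOn_fderiv_of_isOpen e.open_target (by simp)).mono hQt).clm_comp
        continuousOn_const
    have h2 : IsClosed (Q ∩ Z) := h1.preimage_isClosed_of_isClosed hQc.isClosed isClosed_singleton
    refine (hQc.of_isClosed_subset h2 inter_subset_left).image_of_continuousOn ?_
    exact continuousOn_fst.prodMk (hgs.continuousOn.mono (inter_subset_left.trans hQt))
  have hN0 : volume N = 0 := by
    refine (Measure.measure_prod_null hNc.measurableSet).2 (Filter.Eventually.of_forall fun t => ?_)
    have hUt : IsOpen {s : Fin (m + 1) → ℝ | (t, s) ∈ e.target} :=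
      e.open_target.preimage (Continuous.prodMk_right t)
    -- Each slice of `N` consists of values of `g (t, ·)` at points of zero derivative, from
    -- dimension `m + 1` to `m`.
    refine measure_mono_null ?_ (measure_image_fderiv_eq_zero volume (f := fun s => g (t, s)) hUt
      (hgs.comp (contDiff_prodMk_right t).contDiffOn fun s hs => hs) (by simp) (by simpa))
    rintro y ⟨⟨t', s⟩, ⟨hsQ, hsZ⟩, hy⟩
    obtain ⟨rfl, rfl⟩ := Prod.mk.inj hy
    refine ⟨s, ⟨hQt hsQ, ?_⟩, rfl⟩
    exact ((hgd _ (hQt hsQ)).hasFDerivAt.comp s (hasFDerivAt_prodMk_right t' s)).fderiv.trans hsZ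
  have hμN : μ (c ⁻¹' N) = 0 := by
    rw [← Measure.map_apply c.continuous.measurable hNc.measurableSet]
    have : (volume : Measure ((Fin r → ℝ) × (Fin m → ℝ))).IsAddHaarMeasure :=
      Measure.prod.instIsAddHaarMeasure _ _
    exact Measure.absolutelyContinuous_isAddHaarMeasure _ volume hN0
  refine ⟨e.source ∩ e ⁻¹' Q, ?_, measure_mono_null ?_ hμN⟩
  · exact Filter.inter_mem (e.open_source.mem_nhds hpe)
      ((e.continuousAt hpe).preimage_mem_nhds hQ)
  rintro - ⟨x, ⟨⟨hxU, hxr⟩, hxe, hxQ⟩, rfl⟩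
  have hq := e.map_source hxe
  have hl : e.symm (e x) = x := e.left_inv hxe
  have hex : e x = (c₁ (f x), b x) := by rw [he]
  refine ⟨e x, ⟨hxQ, ?_⟩, ?_⟩
  swap
  · have h2 : g (e x) = c₂ (f x) := by simp only [g, hl]
    have h1 : (e x).1 = c₁ (f x) := by rw [hex]
    simp only [h1, h2]
    rfl
  have hS : HasFDerivAt e.symm (fderiv ℝ e.symm (e x)) (e x) :=
    ((hsymm.contDiffAt (e.open_target.mem_nhds hq)).differentiableAt (by simp)).hasFDerivAt
  have hfx : HasFDerivAt f (fderiv ℝ f x) (e.symm (e x)) := by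
    rw [hl]; exact (hfd x hxU).hasFDerivAt
  have hgx : fderiv ℝ g (e x) = c₂ ∘L (fderiv ℝ f x ∘L fderiv ℝ e.symm (e x)) :=
    (c₂.hasFDerivAt.comp (e x) (hfx.comp (e x) hS)).fderiv
  have h1x : c₁ ∘L (fderiv ℝ f x ∘L fderiv ℝ e.symm (e x)) = ContinuousLinearMap.fst ℝ _ _ := by
    refine (c₁.hasFDerivAt.comp (e x) (hfx.comp (e x) hS)).unique
      (hasFDerivAt_fst.congr_of_eventuallyEq ?_)
    filter_upwards [e.open_target.mem_nhds hq] with q hq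
    have := e.right_inv hq
    rw [he] at this
    exact congrArg Prod.fst this
  -- `c₁` maps the `r`-dimensional range of `Df(x)` onto `ℝʳ`, hence injectively. Directions `(0,
  -- σ)` are invisible to `c₁`, so `Df(x)` kills their images under the inverse chart.
  have hinj : ∀ v, c₁ (fderiv ℝ f x v) = 0 → fderiv ℝ f x v = 0 := by
    let k : (fderiv ℝ f x).range →ₗ[ℝ] (Fin r → ℝ) :=
      (c₁ : F →ₗ[ℝ] (Fin r → ℝ)) ∘ₗ (fderiv ℝ f x).range.subtype
    have hk : Function.Surjective k := fun y => by
      have hb' := (hbij x hxe).2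
      rw [hΨ x hxU] at hb'
      obtain ⟨v, hv⟩ := hb' (y, 0)
      exact ⟨⟨_, v, rfl⟩, congrArg Prod.fst hv⟩
    have hk' := (LinearMap.injective_iff_surjective_of_finrank_eq_finrank (by simp [hxr])).2 hk
    intro v hv
    exact congrArg Subtype.val (@hk' ⟨_, v, rfl⟩ 0 (by rw [map_zero]; exact hv))
  ext1 σ
  have h0 := hinj (fderiv ℝ e.symm (e x) (0, σ)) (by
    have := DFunLike.congr_fun h1x (0, σ)
    exact this)
  have := DFunLike.congr_fun hgx (0, σ)
  simp only [ContinuousLinearMap.comp_apply, h0, map_zero] at this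
  exact this

/-- **Sard's theorem** for smooth maps which lower the dimension by one. -/
theorem measure_image_not_surjective_fderiv_eq_zero {f : E → F} {U : Set E} (hU : IsOpen U)
    (hf : ContDiffOn ℝ ∞ f U) (hd : finrank ℝ E = finrank ℝ F + 1) :
    μ (f '' {x ∈ U | ¬ Function.Surjective (fderiv ℝ f x)}) = 0 := by
  have hsub : {x ∈ U | ¬ Function.Surjective (fderiv ℝ f x)} ⊆
      ⋃ r : Fin (finrank ℝ F), {x ∈ U | finrank ℝ (fderiv ℝ f x).range = r} := by
    rintro x ⟨hx, hs⟩
    have h : finrank ℝ (fderiv ℝ f x).range < finrank ℝ F :=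
      Submodule.finrank_lt fun h => hs (LinearMap.range_eq_top.1 h)
    exact mem_iUnion.2 ⟨⟨_, h⟩, hx, rfl⟩
  refine measure_mono_null (image_mono hsub) ?_
  rw [image_iUnion]
  refine measure_iUnion_null fun r => measure_image_null_of_locally_null μ fun p hp => ?_
  exact exists_nhds_measure_image_finrank_range_fderiv_eq μ hU hf hd
    (Nat.add_sub_cancel' r.2.le) (Nat.sub_pos_of_lt r.2) hp.1 hp.2

end Sard

/-! ### Regular zero sets as smooth curves -/

section Curves

variable {E F : Type*} [NormedAddCommGroup E] [NormedSpace ℝ E] [FiniteDimensional ℝ E]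
  [NormedAddCommGroup F] [NormedSpace ℝ F]

/-- Near a regular point, a one-dimensional zero set is a smooth curve along which a given linear
functional `ℓ` moves at constant speed. -/
theorem exists_smooth_curve_of_bijective {H : E → F} {V : Set E} {p : E} (hV : IsOpen V)
    (hp : p ∈ V) (hH : ContDiffOn ℝ ∞ H V) (hp0 : H p = 0) {ℓ : E →L[ℝ] ℝ}
    (hb : Function.Bijective ((fderiv ℝ H p).prod ℓ)) :
    ∃ (ε : ℝ) (U : Set E) (γ : ℝ → E), 0 < ε ∧ IsOpen U ∧ p ∈ U ∧ U ⊆ V ∧ γ 0 = p ∧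
      ContDiffOn ℝ ∞ γ (Ioo (-1) 1) ∧ (∀ t ∈ Ioo (-1 : ℝ) 1, ℓ (γ t) = ℓ p + ε * t) ∧
      γ '' Ioo (-1) 1 = {x ∈ U | H x = 0} := by
  have hHd : DifferentiableAt ℝ H p :=
    (hH.contDiffAt (hV.mem_nhds hp)).differentiableAt (by simp)
  obtain ⟨e, he, hpe, hesub, hsymm, -⟩ := exists_smooth_openPartialHomeomorph
    (f := fun x => (H x, ℓ x)) hV hp (hH.prodMk ℓ.contDiff.contDiffOn)
    (by rw [(hHd.hasFDerivAt.prodMk ℓ.hasFDerivAt).fderiv]; exact hb)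
  have hep : e p = (0, ℓ p) := by rw [he]; simp [hp0]
  have hline : (fun s : ℝ => ((0 : F), ℓ p + s)) ⁻¹' e.target ∈ nhds 0 := by
    refine (show Continuous fun s : ℝ => ((0 : F), ℓ p + s) by fun_prop).continuousAt ?_
    rw [add_zero, ← hep]
    exact e.open_target.mem_nhds (e.map_source hpe)
  obtain ⟨ε, hε, hball⟩ := Metric.mem_nhds_iff.1 hline
  have hmem : ∀ t ∈ Ioo (-1 : ℝ) 1, ((0 : F), ℓ p + ε * t) ∈ e.target := fun t ht => by
    refine hball (mem_ball_zero_iff.2 ?_)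
    rw [Real.norm_eq_abs, abs_mul, abs_of_pos hε]
    have := abs_lt.2 ht
    nlinarith
  have heγ : ∀ t ∈ Ioo (-1 : ℝ) 1,
      (H (e.symm (0, ℓ p + ε * t)), ℓ (e.symm (0, ℓ p + ε * t))) = (0, ℓ p + ε * t) :=
    fun t ht => by
      have := e.right_inv (hmem t ht)
      rwa [he] at this
  -- Trimming by `ℓ` makes the zeros in the neighbourhood exactly the curve points with `|t| < 1`.
  refine ⟨ε, e.source ∩ {x | |ℓ x - ℓ p| < ε}, fun t => e.symm (0, ℓ p + ε * t), hε,
    e.open_source.inter (isOpen_lt (by fun_prop) continuous_const), ⟨hpe, by simpa using hε⟩,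
    inter_subset_left.trans hesub, ?_, ?_, fun t ht => congrArg Prod.snd (heγ t ht), ?_⟩
  · simp only [mul_zero, add_zero]
    rw [← hep, e.left_inv hpe]
  · exact hsymm.comp (ContDiff.contDiffOn (by fun_prop)) hmem
  · ext x
    constructor
    · rintro ⟨t, ht, rfl⟩
      refine ⟨⟨e.map_target (hmem t ht), ?_⟩, congrArg Prod.fst (heγ t ht)⟩
      have h2 : ℓ (e.symm (0, ℓ p + ε * t)) = ℓ p + ε * t := congrArg Prod.snd (heγ t ht)
      have := abs_lt.2 ht
      simp only [mem_ofPred_eq, h2, add_sub_cancel_left, abs_mul, abs_of_pos hε]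
      nlinarith
    · rintro ⟨⟨hxe, hx⟩, hx0⟩
      have hx' : -ε < ℓ x - ℓ p ∧ ℓ x - ℓ p < ε := abs_lt.1 hx
      refine ⟨(ℓ x - ℓ p) / ε, ⟨?_, ?_⟩, ?_⟩
      · rw [lt_div_iff₀ hε]; linarith
      · rw [div_lt_iff₀ hε]; linarith
      · have hex : e x = (0, ℓ p + ε * ((ℓ x - ℓ p) / ε)) := by
          rw [he, mul_div_cancel₀ _ hε.ne']
          simp [hx0]
        simp only [← hex, e.left_inv hxe]

omit [FiniteDimensional ℝ E] in
/-- If a set is locally a curve along which a linear functional has constant nonzero speed, then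
this curve is a smooth parametrization of the connected component. -/
theorem hasSmoothParametrizationAt_connectedComponentIn {Z U : Set E} {p₀ p : E} {γ : ℝ → E}
    {ℓ : E →L[ℝ] ℝ} {ε : ℝ} {I : Set ℝ} (hp : p ∈ connectedComponentIn Z p₀) (hU : IsOpen U)
    (hpU : p ∈ U) (hε : 0 < ε) (h0 : γ 0 = p) (hγ : ContDiffOn ℝ ∞ γ (Ioo (-1) 1))
    (hI : I ⊆ Ioo (-1) 1) (hIc : IsPreconnected I) (hId : UniqueDiffOn ℝ I) (hI0 : 0 ∈ I)
    (hℓ : ∀ t ∈ Ioo (-1 : ℝ) 1, ℓ (γ t) = ℓ p + ε * t) (hZ : γ '' I = Z ∩ U) :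
    HasSmoothParametrizationAt (connectedComponentIn Z p₀) p I := by
  -- The arc is connected and passes through `p`, so it never leaves the component.
  have hsub : γ '' I ⊆ connectedComponentIn Z p₀ := by
    rw [connectedComponentIn_eq hp]
    exact (hIc.image γ (hγ.continuousOn.mono hI)).subset_connectedComponentIn ⟨0, hI0, h0⟩
      (hZ.trans_subset inter_subset_left)
  refine ⟨U, γ, hU, hpU, h0, ?_, hγ.mono hI, fun t ht => ?_, ?_⟩
  · refine Subset.antisymm (subset_inter hsub (hZ.trans_subset inter_subset_right)) ?_
    rw [hZ]
    exact inter_subset_inter_left _ (connectedComponentIn_subset Z p₀)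
  · have hn : Ioo (-1 : ℝ) 1 ∈ nhds t := isOpen_Ioo.mem_nhds (hI ht)
    have hd : DifferentiableAt ℝ γ t := (hγ.contDiffAt hn).differentiableAt (by simp)
    rw [hd.derivWithin (hId t ht)]
    intro h
    have h1 : HasDerivAt (fun s => ℓ (γ s)) (ℓ (deriv γ t)) t :=
      ℓ.hasFDerivAt.comp_hasDerivAt t hd.hasDerivAt
    have h2 : HasDerivAt (fun s => ℓ p + ε * s) (ε * 1) t :=
      ((hasDerivAt_id t).const_mul ε).const_add (ℓ p)
    have h3 := (h2.congr_of_eventuallyEq (Filter.eventually_of_mem hn hℓ)).unique h1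
    rw [h, map_zero] at h3
    linarith
  · have hc : Continuous (I.domRestrict γ) := (hγ.continuousOn.mono hI).domRestrict
    -- The rescaled functional `ℓ` is a continuous left inverse of `γ` on `I`.
    refine Topology.IsEmbedding.of_comp hc
      (g := fun x => (ℓ x - ℓ p) / ε) (by fun_prop) ?_
    convert! Topology.IsEmbedding.subtypeVal (p := (· ∈ I)) using 1
    ext t
    have := hℓ t (hI t.2)
    simp only [Function.comp_apply, domRestrict_apply, this, add_sub_cancel_left]
    exact mul_div_cancel_left₀ _ hε.ne'

end Curves

/-! ### The homotopy as a family of level sets -/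

section Homotopy

variable {n : ℕ} (A : Matrix (Fin n) (Fin n) ℝ) (q : Fin n → ℝ)

/-- The map `(x, z₁, z₂) ↦ (x, Z₁ x, Z₂ (A x + q))`. -/
def complementarityMap (y : TripleSpace n) : TripleSpace n :=
  (y.1, y.2.1 * y.1, y.2.2 * (A *ᵥ y.1 + q))

/-- The inverse of `complementarityMap` where `x` and `A x + q` have no zero entry. -/
noncomputable def complementarityInv (c : TripleSpace n) : TripleSpace n :=
  (c.1, c.2.1 / c.1, c.2.2 / (A *ᵥ c.1 + q))

/-- The map whose level set through `(y₀, 1)`, for `λ > 0`, is the zero set of the homotopy. -/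
noncomputable def levelMap (p : TripleSpace n × ℝ) : TripleSpace n :=
  (((1 - p.2) * p.2⁻¹) • ((A + Aᵀ) *ᵥ p.1.1 + q - p.1.2.1 - Aᵀ *ᵥ p.1.2.2) + p.1.1,
    p.2⁻¹ • (p.1.2.1 * p.1.1), p.2⁻¹ • (p.1.2.2 * (A *ᵥ p.1.1 + q)))

theorem lcpHomotopy_eq_smul (y₀ : TripleSpace n) {p : TripleSpace n × ℝ} (hp : 0 < p.2) :
    lcpHomotopy A q y₀ p = p.2 • (levelMap A q p - complementarityMap A q y₀) := by
  obtain ⟨⟨x, z₁, z₂⟩, l⟩ := p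
  have hl : l ≠ 0 := hp.ne'
  simp only [lcpHomotopy, levelMap, complementarityMap, Prod.mk_sub_mk, Prod.smul_mk, smul_sub,
    smul_add, smul_smul, mul_inv_cancel₀ hl, one_smul]
  rw [show l * ((1 - l) * l⁻¹) = 1 - l by field_simp]
  simp only [add_sub_assoc]

theorem contDiff_mulVec (M : Matrix (Fin n) (Fin n) ℝ) :
    ContDiff ℝ ∞ fun x : Fin n → ℝ => M *ᵥ x :=
  (LinearMap.toContinuousLinearMap M.mulVecLin).contDiff

theorem contDiff_lcpHomotopy (y₀ : TripleSpace n) : ContDiff ℝ ∞ (lcpHomotopy A q y₀) := by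
  have hA := contDiff_mulVec A
  have hB := contDiff_mulVec Aᵀ
  have hC := contDiff_mulVec (A + Aᵀ)
  change ContDiff ℝ ∞ fun p : TripleSpace n × ℝ =>
    ((1 - p.2) • ((A + Aᵀ) *ᵥ p.1.1 + q - p.1.2.1 - Aᵀ *ᵥ p.1.2.2) + p.2 • (p.1.1 - y₀.1),
      p.1.2.1 * p.1.1 - p.2 • (y₀.2.1 * y₀.1),
      p.1.2.2 * (A *ᵥ p.1.1 + q) - p.2 • (y₀.2.2 * (A *ᵥ y₀.1 + q)))
  fun_prop

theorem contDiffOn_levelMap : ContDiffOn ℝ ∞ (levelMap A q) {p | 0 < p.2} := by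
  have hA := contDiff_mulVec A
  have hB := contDiff_mulVec Aᵀ
  have hC := contDiff_mulVec (A + Aᵀ)
  have hinv : ContDiffOn ℝ ∞ (fun p : TripleSpace n × ℝ => p.2⁻¹) {p | 0 < p.2} :=
    contDiff_snd.contDiffOn.inv fun p hp => ne_of_gt hp
  unfold levelMap
  fun_prop

theorem contDiff_complementarityMap : ContDiff ℝ ∞ (complementarityMap A q) := by
  have hA := contDiff_mulVec A
  unfold complementarityMap
  fun_prop

variable {A q} {y y₀ : TripleSpace n}

theorem complementarityInv_complementarityMap (hy : y ∈ strictlyFeasibleTriples A q) :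
    complementarityInv A q (complementarityMap A q y) = y := by
  obtain ⟨⟨h1, h2⟩, -⟩ := hy
  refine Prod.ext rfl (Prod.ext (funext fun i => ?_) (funext fun i => ?_))
  · exact mul_div_cancel_right₀ _ (h1 i).ne'
  · exact mul_div_cancel_right₀ _ (h2 i).ne'

theorem differentiableAt_complementarityInv (hy : y ∈ strictlyFeasibleTriples A q) :
    DifferentiableAt ℝ (complementarityInv A q) (complementarityMap A q y) := by
  obtain ⟨⟨h1, h2⟩, -⟩ := hy
  have hA : Differentiable ℝ fun x : Fin n → ℝ => A *ᵥ x :=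
    (contDiff_mulVec A).differentiable (by simp)
  have hd : ∀ i, DifferentiableAt ℝ (fun c : TripleSpace n => (A *ᵥ c.1 + q) i)
      (complementarityMap A q y) := by
    have : DifferentiableAt ℝ (fun c : TripleSpace n => A *ᵥ c.1 + q)
      (complementarityMap A q y) := by fun_prop
    exact differentiableAt_pi.1 this
  refine differentiableAt_fst.prodMk (DifferentiableAt.prodMk ?_ ?_)
  · refine differentiableAt_pi.2 fun i => ?_
    have h3 : DifferentiableAt ℝ (fun c : TripleSpace n => c.2.1 i) (complementarityMap A q y) := by
      fun_prop
    have h4 : DifferentiableAt ℝ (fun c : TripleSpace n => c.1 i) (complementarityMap A q y) := by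
      fun_prop
    exact (h3.mul (h4.fun_inv (h1 i).ne')).congr_of_eventuallyEq
      (Filter.Eventually.of_forall fun c => div_eq_mul_inv _ _)
  · refine differentiableAt_pi.2 fun i => ?_
    have h3 : DifferentiableAt ℝ (fun c : TripleSpace n => c.2.2 i) (complementarityMap A q y) := by
      fun_prop
    exact (h3.mul ((hd i).fun_inv (h2 i).ne')).congr_of_eventuallyEq
      (Filter.Eventually.of_forall fun c => div_eq_mul_inv _ _)

theorem isOpen_strictlyFeasibleTriples : IsOpen (strictlyFeasibleTriples A q) := by
  have hA : Continuous fun x : Fin n → ℝ => A *ᵥ x := (contDiff_mulVec A).continuous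
  have hpos : IsOpen {z : Fin n → ℝ | ∀ i, 0 < z i} := by
    simp only [ofPred_forall]
    exact isOpen_iInter_of_finite fun i => isOpen_lt continuous_const (continuous_apply i)
  exact (hpos.inter (hpos.preimage (hA.add continuous_const))).prod (hpos.prod hpos)

theorem injective_fderiv_complementarityMap (hy : y ∈ strictlyFeasibleTriples A q) :
    Function.Injective (fderiv ℝ (complementarityMap A q) y) := by
  have h1 := (differentiableAt_complementarityInv hy).hasFDerivAt.comp y
    ((contDiff_complementarityMap A q).differentiable (by simp) y).hasFDerivAt
  have h2 := h1.unique ((hasFDerivAt_id y).congr_of_eventuallyEq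
    (Filter.eventually_of_mem (isOpen_strictlyFeasibleTriples.mem_nhds hy)
      fun _ => complementarityInv_complementarityMap))
  exact Function.LeftInverse.injective (DFunLike.congr_fun h2)

theorem eq_of_lcpHomotopy_one_eq_zero (hy₀ : y₀ ∈ strictlyFeasibleTriples A q)
    (hy : y ∈ strictlyFeasibleTriples A q) (h : lcpHomotopy A q y₀ (y, 1) = 0) : y = y₀ := by
  rw [lcpHomotopy_eq_smul A q y₀ one_pos, one_smul, sub_eq_zero] at h
  have h1 : levelMap A q (y, 1) = complementarityMap A q y := by
    simp [levelMap, complementarityMap]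
  rw [← complementarityInv_complementarityMap hy₀, ← h, h1,
    complementarityInv_complementarityMap hy]

theorem lcpHomotopy_self : lcpHomotopy A q y₀ (y₀, 1) = 0 := by
  simp [lcpHomotopy]

theorem finrank_tripleSpace_prod :
    Module.finrank ℝ (TripleSpace n × ℝ) = Module.finrank ℝ (TripleSpace n) + 1 := by
  simp

/-- At its starting point, the zero set is transversal to the slices `λ = const`. -/
theorem bijective_fderiv_lcpHomotopy_prod_snd (hy₀ : y₀ ∈ strictlyFeasibleTriples A q) :
    Function.Bijective ((fderiv ℝ (lcpHomotopy A q y₀) (y₀, 1)).prod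
      (-ContinuousLinearMap.snd ℝ (TripleSpace n) ℝ)) := by
  let L := (fderiv ℝ (lcpHomotopy A q y₀) (y₀, 1)).prod (-ContinuousLinearMap.snd ℝ _ ℝ)
  have hinj : Function.Injective (L : TripleSpace n × ℝ →ₗ[ℝ] TripleSpace n × ℝ) := by
    rw [← LinearMap.ker_eq_bot, LinearMap.ker_eq_bot']
    rintro ⟨v, τ⟩ hv
    obtain rfl : τ = 0 := neg_eq_zero.1 (congrArg Prod.snd hv)
    have h1 : fderiv ℝ (lcpHomotopy A q y₀) (y₀, 1) (v, 0) = 0 := congrArg Prod.fst hv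
    have h2 := ((contDiff_lcpHomotopy A q y₀).differentiable (by simp) (y₀, 1)).hasFDerivAt.comp y₀
      (hasFDerivAt_prodMk_left (𝕜 := ℝ) y₀ (1 : ℝ))
    have h3 : HasFDerivAt (fun y => complementarityMap A q y - complementarityMap A q y₀)
        (fderiv ℝ (complementarityMap A q) y₀) y₀ :=
      ((contDiff_complementarityMap A q).differentiable (by simp) y₀).hasFDerivAt.sub_const _
    have h4 : (fun y => complementarityMap A q y - complementarityMap A q y₀) =
        lcpHomotopy A q y₀ ∘ fun y => (y, 1) := by
      funext y
      simp [lcpHomotopy, complementarityMap]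
    rw [h4] at h3
    have h5 := DFunLike.congr_fun (h3.unique h2) v
    have h6 : fderiv ℝ (complementarityMap A q) y₀ v = 0 := h5.trans h1
    rw [injective_fderiv_complementarityMap hy₀ (h6.trans (map_zero _).symm)]
    rfl
  exact ⟨hinj, LinearMap.injective_iff_surjective.1 hinj⟩

/-- At a zero, the product rule for `λ • (G - c(y₀))` loses the term differentiating `λ`, leaving `λ
• DG`. -/
theorem surjective_fderiv_lcpHomotopy {p : TripleSpace n × ℝ} (hp : 0 < p.2)
    (h0 : lcpHomotopy A q y₀ p = 0)
    (hs : Function.Surjective (fderiv ℝ (levelMap A q) p)) :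
    Function.Surjective (fderiv ℝ (lcpHomotopy A q y₀) p) := by
  have hopen : {p : TripleSpace n × ℝ | 0 < p.2} ∈ nhds p :=
    (isOpen_lt continuous_const continuous_snd).mem_nhds hp
  have hd := (((contDiffOn_levelMap A q).contDiffAt hopen).differentiableAt
    (by simp)).hasFDerivAt.sub_const (complementarityMap A q y₀)
  have h1 := ((hasFDerivAt_snd (𝕜 := ℝ) (p := p)).smul hd).congr_of_eventuallyEq
    (Filter.eventually_of_mem hopen fun p' hp' => lcpHomotopy_eq_smul A q y₀ hp')
  rw [lcpHomotopy_eq_smul A q y₀ hp, smul_eq_zero_iff_right hp.ne'] at h0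
  rw [h1.fderiv, h0]
  intro c
  obtain ⟨v, hv⟩ := hs (p.2⁻¹ • c)
  refine ⟨v, ?_⟩
  simp [hv, smul_smul, mul_inv_cancel₀ hp.ne']

/-- The bad `y₀` lie in the image, under the differentiable `complementarityInv`, of the critical
values of `levelMap` that are attained by `complementarityMap` on `𝓕₁`; differentiable maps between
spaces of equal dimension preserve null sets. -/
theorem ae_surjective_fderiv_levelMap :
    ∀ᵐ y₀ : TripleSpace n ∂volume, y₀ ∈ strictlyFeasibleTriples A q →
      ∀ p : TripleSpace n × ℝ, 0 < p.2 → levelMap A q p = complementarityMap A q y₀ →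
        Function.Surjective (fderiv ℝ (levelMap A q) p) := by
  have : (volume : Measure ((Fin n → ℝ) × (Fin n → ℝ))).IsAddHaarMeasure :=
    Measure.prod.instIsAddHaarMeasure _ _
  have : (volume : Measure (TripleSpace n)).IsAddHaarMeasure :=
    Measure.prod.instIsAddHaarMeasure _ _
  have hsard := measure_image_not_surjective_fderiv_eq_zero (volume : Measure (TripleSpace n))
    (isOpen_lt continuous_const continuous_snd) (contDiffOn_levelMap A q) finrank_tripleSpace_prod
  set S := levelMap A q '' {p | p ∈ {p | 0 < p.2} ∧ ¬ Function.Surjective (fderiv ℝ (levelMap A q) p)}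
  have hnull : volume (complementarityInv A q ''
      (S ∩ complementarityMap A q '' strictlyFeasibleTriples A q)) = 0 := by
    refine addHaar_image_eq_zero_of_differentiableOn_of_addHaar_eq_zero _ ?_
      (measure_mono_null inter_subset_left hsard)
    rintro - ⟨-, y, hy, rfl⟩
    exact (differentiableAt_complementarityInv hy).differentiableWithinAt
  rw [ae_iff]
  refine measure_mono_null (fun y₀ hy₀ => ?_) hnull
  simp only [mem_ofPred_eq, Classical.not_imp, not_forall] at hy₀
  obtain ⟨hy, p, hp, hpc, hps⟩ := hy₀
  exact ⟨complementarityMap A q y₀, ⟨⟨p, ⟨hp, hps⟩, hpc⟩, y₀, hy, rfl⟩,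
    complementarityInv_complementarityMap hy⟩

theorem isSmoothCurveFrom_connectedComponentIn (hy₀ : y₀ ∈ strictlyFeasibleTriples A q)
    (hreg : ∀ p : TripleSpace n × ℝ, 0 < p.2 → lcpHomotopy A q y₀ p = 0 →
      Function.Surjective (fderiv ℝ (lcpHomotopy A q y₀) p)) :
    IsSmoothCurveFrom (connectedComponentIn (homotopyZeroSet A q y₀) (y₀, 1)) (y₀, 1) := by
  have hopen := isOpen_strictlyFeasibleTriples (A := A) (q := q)
  have hsmooth := contDiff_lcpHomotopy A q y₀
  have hmem : (y₀, (1 : ℝ)) ∈ homotopyZeroSet A q y₀ :=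
    ⟨⟨hy₀, one_pos, le_rfl⟩, lcpHomotopy_self⟩
  have hmem' := mem_connectedComponentIn hmem
  refine ⟨isConnected_connectedComponentIn_iff.2 hmem, hmem', ?_, ?_⟩
  -- The homotopy is smooth beyond `λ = 1`, so the curve is first built across it. With `ℓ = -λ`,
  -- the condition `λ ≤ 1` becomes `t ≥ 0`, which gives the half-open interval.
  · obtain ⟨ε, U, γ, hε, hU, hpU, hUV, h0, hγ, hℓ, himg⟩ := exists_smooth_curve_of_bijective
      (hopen.prod (isOpen_Ioi (a := (0 : ℝ)))) (p := (y₀, (1 : ℝ))) ⟨hy₀, mem_Ioi.2 one_pos⟩ hsmooth.contDiffOn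
      lcpHomotopy_self (bijective_fderiv_lcpHomotopy_prod_snd hy₀)
    have hI : Ico (0 : ℝ) 1 ⊆ Ioo (-1) 1 := fun t ht => ⟨by linarith [ht.1], ht.2⟩
    have hsnd : ∀ t ∈ Ioo (-1 : ℝ) 1, (γ t).2 = 1 - ε * t := fun t ht => by
      have : -(γ t).2 = -1 + ε * t := hℓ t ht
      linarith
    refine hasSmoothParametrizationAt_connectedComponentIn hmem' hU hpU hε h0 hγ hI
      isPreconnected_Ico (uniqueDiffOn_Ico 0 1) (by simp) hℓ ?_
    ext x
    constructor
    · rintro ⟨t, ht, rfl⟩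
      have hx : γ t ∈ {x ∈ U | lcpHomotopy A q y₀ x = 0} := himg ▸ mem_image_of_mem γ (hI ht)
      have hV := hUV hx.1
      refine ⟨⟨⟨hV.1, hV.2, ?_⟩, hx.2⟩, hx.1⟩
      rw [hsnd t (hI ht)]
      nlinarith [ht.1]
    · rintro ⟨⟨⟨-, -, hx1⟩, hx0⟩, hxU⟩
      obtain ⟨t, ht, rfl⟩ : x ∈ γ '' Ioo (-1) 1 := himg ▸ ⟨hxU, hx0⟩
      rw [hsnd t ht] at hx1
      exact ⟨t, ⟨by nlinarith, ht.2⟩, rfl⟩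
  · intro p hp hne
    obtain ⟨⟨hp1, hp2, hp3⟩, hp0⟩ := connectedComponentIn_subset _ _ hp
    -- Uniqueness of the zero on `λ = 1` puts every other point in the open region `0 < λ < 1`,
    -- where the zero set has no edge.
    have hlt : p.2 < 1 := by
      refine lt_of_le_of_ne hp3 fun h => hne ?_
      have hp' : p = (p.1, 1) := Prod.ext rfl h
      rw [hp'] at hp0
      rw [hp', eq_of_lcpHomotopy_one_eq_zero hy₀ hp1 hp0]
    obtain ⟨ℓ, hb⟩ := exists_bijective_prod_of_surjective (B := ℝ)
      (fderiv ℝ (lcpHomotopy A q y₀) p) (hreg p hp2 hp0)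
      (by rw [finrank_tripleSpace_prod, Module.finrank_self])
    obtain ⟨ε, U, γ, hε, hU, hpU, hUV, h0, hγ, hℓ, himg⟩ := exists_smooth_curve_of_bijective
      (hopen.prod (isOpen_Ioo (a := (0 : ℝ)) (b := 1))) (p := p) ⟨hp1, hp2, hlt⟩ hsmooth.contDiffOn hp0 hb
    refine hasSmoothParametrizationAt_connectedComponentIn hp hU hpU hε h0 hγ Subset.rfl
      isPreconnected_Ioo (uniqueDiffOn_Ioo _ _) (by simp) hℓ (himg.trans ?_)
    ext x
    constructor
    · rintro ⟨hxU, hx0⟩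
      obtain ⟨h1, h2, h3⟩ := hUV hxU
      exact ⟨⟨⟨h1, h2, h3.le⟩, hx0⟩, hxU⟩
    · rintro ⟨⟨-, hx0⟩, hxU⟩
      exact ⟨hxU, hx0⟩

end Homotopy

/-! ### Conclusion -/

theorem mainTheorem2 (n : ℕ) (A : Matrix (Fin n) (Fin n) ℝ) (q : Fin n → ℝ) :
    ∀ᵐ y₀ : TripleSpace n ∂volume, y₀ ∈ strictlyFeasibleTriples A q →
      IsRegularValueOn (lcpHomotopy A q y₀) (univ ×ˢ Ioc (0 : ℝ) 1) 0 ∧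
      ∃ Γ ⊆ homotopyZeroSet A q y₀,
        Γ = connectedComponentIn (homotopyZeroSet A q y₀) (y₀, 1) ∧
        IsSmoothCurveFrom Γ (y₀, 1) := by
  filter_upwards [ae_surjective_fderiv_levelMap (A := A) (q := q)] with y₀ hlevel hy₀
  have hreg : ∀ p : TripleSpace n × ℝ, 0 < p.2 → lcpHomotopy A q y₀ p = 0 →
      Function.Surjective (fderiv ℝ (lcpHomotopy A q y₀) p) := fun p hp h0 => by
    refine surjective_fderiv_lcpHomotopy hp h0 (hlevel hy₀ p hp ?_)
    rw [lcpHomotopy_eq_smul A q y₀ hp, smul_eq_zero_iff_right hp.ne'] at h0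
    exact sub_eq_zero.1 h0
  refine ⟨fun p hp h0 => ?_, _, connectedComponentIn_subset _ _, rfl,
    isSmoothCurveFrom_connectedComponentIn hy₀ hreg⟩
  have hd := (contDiff_lcpHomotopy A q y₀).differentiable (by simp) p
  -- Unique differentiability identifies the one-sided derivative at `λ = 1` with the full one.
  have hu : UniqueDiffOn ℝ ((univ : Set (TripleSpace n)) ×ˢ Ioc (0 : ℝ) 1) :=
    uniqueDiffOn_univ.prod (uniqueDiffOn_Ioc 0 1)
  refine ⟨hd.differentiableWithinAt, ?_⟩
  rw [hd.fderivWithin (hu p hp)]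
  exact hreg p hp.2.1 h0
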